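/- Let $K$ be a field, let $R=K[x_1,\dots,x_n]$ and $\mathfrak m=(x_1,\dots,x_n)$. Let $A$ be an abelian group and let $R$ be $A$-graded with $\deg x_i=w_i\in A$ (for example $A=\mathbb Z$, $w_i=1$, the standard grading, or $A=\mathbb Z^n$, $w_i$ the $i$-th unit vector, the multigrading). By a minimal free resolution of an ideal $I\subseteq R$ we mean a complex $\mathbb M(I)\colon \cdots\to M_2\to M_1\to M_0$ of finitely generated free $A$-graded $R$-modules with homogeneous differentials of degree $0$ and with a homogeneous surjection $M_0\to R/I$ of degree $0$, such that $\cdots\to M_2\to M_1\to M_0\to R/I\to 0$ is exact and $d(M_{i+1})\subseteq \mathfrak m M_i$ for all $i\ge 0$ (so it is a minimal resolution of the cyclic module $R/I$). Let $I$ and $J$ be monomial ideals of $R$ such that $I\cdot J=I\cap J$, and let $\mathbb M(I)$ and $\mathbb M(J)$ be minimal free resolutions of $I$ and $J$. Then the tensor product complex $\mathbb M(I)\otimes_R\mathbb M(J)$ is a minimal free resolution of $I+J$. -/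

import Mathlib

universe u v

open CategoryTheory

/-- An ideal of `K[x₁, …, xₙ]` generated by monomials. -/
def IsMonomialIdeal {K : Type*} [Field K] {n : ℕ} (I : Ideal (MvPolynomial (Fin n) K)) : Prop :=
  ∃ S : Set (Fin n →₀ ℕ), I = Ideal.span ((fun s => MvPolynomial.monomial s (1 : K)) '' S)

/-- The ideal `(x₁, …, xₙ)` of `K[x₁, …, xₙ]`. -/
noncomputable def irrelevantIdeal (K : Type*) [Field K] (n : ℕ) : Ideal (MvPolynomial (Fin n) K) :=
  Ideal.span (Set.range MvPolynomial.X)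

/-- Let `R = K[x₁, …, xₙ]` be graded by the abelian group `A`, the variable `xᵢ` having degree
`w i` (`A = ℤ` and `w i = 1` is the standard grading, `A = ℤⁿ` and `w i` the `i`-th unit vector
the multigrading). A graded free resolution structure on the chain complex `F` for the cyclic
module `R ⧸ I`: finite bases of the `F_i` whose elements are assigned degrees in `A`, such that
the differentials and the augmentation `F₀ → R ⧸ I` are homogeneous of degree `0`, and such that
`⋯ → F₂ → F₁ → F₀ → R ⧸ I → 0` is exact. -/
structure GradedFreeResolution {K : Type u} [Field K] {n : ℕ} {A : Type v} [AddCommGroup A]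
    (w : Fin n → A) (I : Ideal (MvPolynomial (Fin n) K))
    (F : ChainComplex (ModuleCat.{u} (MvPolynomial (Fin n) K)) ℕ) where
  /-- the rank of `F_i` -/
  rank : ℕ → ℕ
  /-- a basis of `F_i` -/
  basis : ∀ i, Module.Basis (Fin (rank i)) (MvPolynomial (Fin n) K) (F.X i)
  /-- the degrees of the basis elements -/
  deg : ∀ i, Fin (rank i) → A
  /-- the augmentation -/
  aug : F.X 0 →ₗ[MvPolynomial (Fin n) K] (MvPolynomial (Fin n) K ⧸ I)
  /-- the differential maps a basis element to a homogeneous element of the same degree -/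
  d_homogeneous : ∀ (i : ℕ) (j : Fin (rank (i + 1))) (k : Fin (rank i)),
    MvPolynomial.IsWeightedHomogeneous w
      ((basis i).repr ((F.d (i + 1) i).hom (basis (i + 1) j)) k) (deg (i + 1) j - deg i k)
  /-- the augmentation maps a basis element to a homogeneous element of the same degree -/
  aug_homogeneous : ∀ j : Fin (rank 0), ∃ p : MvPolynomial (Fin n) K,
    MvPolynomial.IsWeightedHomogeneous w p (deg 0 j) ∧
      aug (basis 0 j) = Ideal.Quotient.mk I p
  aug_surjective : Function.Surjective aug
  exact_zero : Function.Exact (F.d 1 0).hom aug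
  exact_succ : ∀ i : ℕ, Function.Exact (F.d (i + 2) (i + 1)).hom (F.d (i + 1) i).hom

/-- The complex `F` is a minimal free resolution of the ideal `I` (that is, of `R ⧸ I`, with
`F₀` in homological degree `0` mapping onto `R ⧸ I`): it is a graded free resolution and
`d (F_{i+1}) ⊆ (x₁, …, xₙ) F_i` for all `i`. -/
def IsMinimalFreeResolution {K : Type u} [Field K] {n : ℕ} {A : Type v} [AddCommGroup A]
    (w : Fin n → A) (I : Ideal (MvPolynomial (Fin n) K))
    (F : ChainComplex (ModuleCat.{u} (MvPolynomial (Fin n) K)) ℕ) : Prop :=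
  Nonempty (GradedFreeResolution w I F) ∧
    ∀ i : ℕ, LinearMap.range (F.d (i + 1) i).hom ≤
      irrelevantIdeal K n • (⊤ : Submodule (MvPolynomial (Fin n) K) (F.X i))

/-!
For monomial ideals, `I * J = I ⊓ J` forces the minimal monomial generators of `I` and of `J` to
involve disjoint sets of variables (`minimalExponents_disjoint`). Indeed, among the pairs of
generators with a common variable take one with the smallest least common multiple `e`. As `e` lies
in `I ⊓ J = I * J`, it is divisible by a product of two generators, and comparing this new pair
with the old one contradicts minimality.

Disjointness of variables gives the vanishing of `Tor_i(R ⧸ I, R ⧸ J)` for `i > 0`, stated here as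
exactness of `F ⊗ R ⧸ J` in positive degrees for the given free resolution `F` of `R ⧸ I`
(`mem_range_sup_of_d_mem_monomialIdeal_smul_top`). The proof is by induction on the number of
generators of `J = J' + (m)`, through the exact sequence
`0 → R ⧸ (J' : m) → R ⧸ J' → R ⧸ J → 0`: the ideal `J' : m` is again a monomial ideal with fewer
generators in the same variables, and `(I + J') : m = I + (J' : m)` since `m` has no variable in
common with `I`.

Since the `F_p` are free, the complexes `F_p ⊗ G` are exact in positive degrees, and a diagram chase
in the double complex deduces exactness of `F ⊗ G` in positive degrees from that of `F ⊗ R ⧸ J`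
(`TensorTerm.exact_succ`). In degree `0`, right exactness of the tensor product and
`R ⧸ I ⊗ R ⧸ J ≃ R ⧸ (I + J)` yield the augmentation (`TensorTerm.exact_zero`). Homogeneity and
minimality are read off from the components of the differential (`TensorTerm.proj_d`).
-/

/-! ### The tensor product of two complexes of modules -/

/-- The bidegrees `(p, q)` of total degree `k`. -/
abbrev BidegreesOfTotal (k : ℕ) : Type := {x : ℕ × ℕ // x.1 + x.2 = k}

noncomputable instance (k : ℕ) : Fintype (BidegreesOfTotal k) :=
  Fintype.subtype (Finset.HasAntidiagonal.antidiagonal k)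
    fun _ => Finset.HasAntidiagonal.mem_antidiagonal

open TensorProduct in
/-- The degree `k` part of the tensor product of two complexes of modules, as a plain product. -/
abbrev TensorTerm {R : Type u} [CommRing R] (F G : ChainComplex (ModuleCat.{u} R) ℕ) (k : ℕ) :
    Type u :=
  ∀ x : BidegreesOfTotal k, F.X x.1.1 ⊗[R] G.X x.1.2

namespace TensorTerm

open HomologicalComplex TensorProduct

variable {R : Type u} [CommRing R] (F G : ChainComplex (ModuleCat.{u} R) ℕ)

/-- The inclusion of a summand in the tensor product complex, as a linear map. -/
noncomputable def incl (p q k : ℕ) (h : p + q = k) :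
    F.X p ⊗[R] G.X q →ₗ[R] (tensorObj F G).X k :=
  (ιTensorObj F G p q k h).hom

variable {F G} in
lemma linearMap_ext {k : ℕ} {M : Type u} [AddCommGroup M] [Module R M]
    {f g : (tensorObj F G).X k →ₗ[R] M}
    (h : ∀ p q (h : p + q = k), f ∘ₗ incl F G p q k h = g ∘ₗ incl F G p q k h) : f = g := by
  have : ModuleCat.ofHom f = ModuleCat.ofHom g := by
    apply mapBifunctor.hom_ext
    intro p q hpq
    ext1
    exact h p q hpq
  exact congrArg ModuleCat.Hom.hom this

/-- The projections of `F ⊗ G` onto its summands in degree `k`, as a map to the product. It is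
obtained from the universal property of the coproduct that defines `F ⊗ G`. -/
noncomputable def toPi (k : ℕ) : (tensorObj F G).X k →ₗ[R] TensorTerm F G k :=
  (mapBifunctorDesc (K₁ := F) (K₂ := G) (F := MonoidalCategory.curriedTensor _)
    (c := ComplexShape.down ℕ) (A := ModuleCat.of R (TensorTerm F G k)) (j := k)
    (fun p q h => ModuleCat.ofHom (LinearMap.single R
      (fun x : BidegreesOfTotal k => F.X x.1.1 ⊗[R] G.X x.1.2)
        ⟨(p, q), h⟩))).hom

lemma toPi_incl (p q k : ℕ) (h : p + q = k) (t : F.X p ⊗[R] G.X q) :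
    toPi F G k (incl F G p q k h t) =
      Pi.single (M := fun x : BidegreesOfTotal k => F.X x.1.1 ⊗[R] G.X x.1.2)
        ⟨(p, q), h⟩ t := by
  have := ι_mapBifunctorDesc (K₁ := F) (K₂ := G) (F := MonoidalCategory.curriedTensor _)
    (c := ComplexShape.down ℕ) (A := ModuleCat.of R (TensorTerm F G k)) (j := k)
    (fun p q h => ModuleCat.ofHom (LinearMap.single R
      (fun x : BidegreesOfTotal k => F.X x.1.1 ⊗[R] G.X x.1.2)
        ⟨(p, q), h⟩)) p q h
  exact LinearMap.congr_fun (congrArg ModuleCat.Hom.hom this) t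

/-- The degree `k` part of `F ⊗ G` is the product of the `F_p ⊗ G_q` with `p + q = k`. -/
noncomputable def equiv (k : ℕ) : (tensorObj F G).X k ≃ₗ[R] TensorTerm F G k :=
  LinearEquiv.ofLinearMap (toPi F G k)
    (∑ x : BidegreesOfTotal k, incl F G x.1.1 x.1.2 k x.2 ∘ₗ
      LinearMap.proj x)
    (by
      refine LinearMap.pi_ext' fun x => LinearMap.ext fun t => ?_
      simp only [LinearMap.comp_apply, LinearMap.sum_apply, LinearMap.proj_apply, map_sum,
        toPi_incl, LinearMap.id_apply]
      exact Finset.univ_sum_single _)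
    (by
      refine linearMap_ext fun p q h => LinearMap.ext fun t => ?_
      simp only [LinearMap.comp_apply, LinearMap.sum_apply, LinearMap.proj_apply,
        toPi_incl, LinearMap.id_apply]
      rw [Finset.sum_eq_single ⟨(p, q), h⟩]
      · simp
      · intro b _ hb
        simp [hb]
      · simp)

@[simp]
lemma equiv_incl (p q k : ℕ) (h : p + q = k) (t : F.X p ⊗[R] G.X q) :
    equiv F G k (incl F G p q k h t) =
      Pi.single (M := fun x : BidegreesOfTotal k => F.X x.1.1 ⊗[R] G.X x.1.2)
        ⟨(p, q), h⟩ t :=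
  toPi_incl F G p q k h t

lemma equiv_symm_single (k : ℕ) (x : BidegreesOfTotal k) (t : F.X x.1.1 ⊗[R] G.X x.1.2) :
    (equiv F G k).symm (Pi.single (M := fun x : BidegreesOfTotal k => F.X x.1.1 ⊗[R] G.X x.1.2)
      x t) = incl F G x.1.1 x.1.2 k x.2 t := by
  rw [LinearEquiv.symm_apply_eq, equiv_incl]

/-- The projection of `F ⊗ G` onto a summand. -/
noncomputable def proj (p q k : ℕ) (h : p + q = k) :
    (tensorObj F G).X k →ₗ[R] F.X p ⊗[R] G.X q :=
  (LinearMap.proj (R := R) (φ := fun x : BidegreesOfTotal k => F.X x.1.1 ⊗[R] G.X x.1.2)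
    ⟨(p, q), h⟩) ∘ₗ (equiv F G k).toLinearMap

@[simp]
lemma proj_incl_self (p q k : ℕ) (h : p + q = k) (t : F.X p ⊗[R] G.X q) :
    proj F G p q k h (incl F G p q k h t) = t := by
  simp [proj]

lemma proj_incl_of_ne {p q p' q' k : ℕ} (h : p + q = k) (h' : p' + q' = k) (hp : p ≠ p')
    (t : F.X p ⊗[R] G.X q) : proj F G p' q' k h' (incl F G p q k h t) = 0 := by
  simp only [proj, LinearMap.comp_apply, LinearEquiv.coe_coe, equiv_incl, LinearMap.proj_apply]
  rw [Pi.single_eq_of_ne]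
  intro h
  simp only [Subtype.mk.injEq, Prod.mk.injEq] at h
  exact hp h.1.symm

lemma ext_proj {k : ℕ} {z z' : (tensorObj F G).X k}
    (h : ∀ p q (h : p + q = k), proj F G p q k h z = proj F G p q k h z') : z = z' :=
  (equiv F G k).injective (funext fun x => h _ _ x.2)

lemma sum_incl_proj {k : ℕ} (z : (tensorObj F G).X k) :
    ∑ x : BidegreesOfTotal k, incl F G x.1.1 x.1.2 k x.2
      (proj F G x.1.1 x.1.2 k x.2 z) = z := by
  have := (equiv F G k).symm_apply_apply z
  conv_rhs => rw [← this]
  simp [equiv, proj]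

lemma d_incl (p q k : ℕ) (h : p + q = k + 1) (t : F.X p ⊗[R] G.X q) :
    ((tensorObj F G).d (k + 1) k).hom (incl F G p q (k + 1) h t) =
      (mapBifunctor.d₁ F G (MonoidalCategory.curriedTensor _) (ComplexShape.down ℕ) p q k).hom t +
      (mapBifunctor.d₂ F G (MonoidalCategory.curriedTensor _) (ComplexShape.down ℕ) p q k).hom t := by
  have : ιTensorObj F G p q (k + 1) h ≫ (tensorObj F G).d (k + 1) k =
     (mapBifunctor.d₁ F G (MonoidalCategory.curriedTensor _) (ComplexShape.down ℕ) p q k) +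
      (mapBifunctor.d₂ F G (MonoidalCategory.curriedTensor _) (ComplexShape.down ℕ) p q k) := by
    rw [mapBifunctor.d_eq, Preadditive.comp_add, mapBifunctor.ι_D₁, mapBifunctor.ι_D₂]
  exact LinearMap.congr_fun (congrArg ModuleCat.Hom.hom this) t

lemma d₁_succ (p q k : ℕ) (h : p + q = k) (t : F.X (p + 1) ⊗[R] G.X q) :
    (mapBifunctor.d₁ F G (MonoidalCategory.curriedTensor _) (ComplexShape.down ℕ) (p + 1) q k).hom t
      = incl F G p q k h ((F.d (p + 1) p).hom.rTensor (G.X q) t) := by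
  rw [mapBifunctor.d₁_eq F G _ (ComplexShape.down ℕ) (i₁ := p + 1) (i₁' := p) (by simp) q k h]
  simp
  rfl

lemma d₁_zero (q k : ℕ) :
    mapBifunctor.d₁ F G (MonoidalCategory.curriedTensor _) (ComplexShape.down ℕ) 0 q k = 0 :=
  mapBifunctor.d₁_eq_zero _ _ _ _ _ _ _ (by simp)

lemma d₂_succ (p q k : ℕ) (h : p + q = k) (t : F.X p ⊗[R] G.X (q + 1)) :
    (mapBifunctor.d₂ F G (MonoidalCategory.curriedTensor _) (ComplexShape.down ℕ) p (q + 1) k).hom t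
      = (-1 : ℤˣ) ^ p • incl F G p q k h ((G.d (q + 1) q).hom.lTensor (F.X p) t) := by
  rw [mapBifunctor.d₂_eq F G _ (ComplexShape.down ℕ) p (i₂ := q + 1) (i₂' := q) (by simp) k h]
  simp
  rfl

lemma d₂_zero (p k : ℕ) :
    mapBifunctor.d₂ F G (MonoidalCategory.curriedTensor _) (ComplexShape.down ℕ) p 0 k = 0 :=
  mapBifunctor.d₂_eq_zero _ _ _ _ _ _ _ (by simp)

/-- The components of the differential of the tensor product complex. -/
lemma proj_d (p q k : ℕ) (h : p + q = k) (z : (tensorObj F G).X (k + 1)) :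
    proj F G p q k h (((tensorObj F G).d (k + 1) k).hom z) =
      (F.d (p + 1) p).hom.rTensor (G.X q) (proj F G (p + 1) q (k + 1) (by omega) z) +
      (-1 : ℤˣ) ^ p •
        (G.d (q + 1) q).hom.lTensor (F.X p) (proj F G p (q + 1) (k + 1) (by omega) z) := by
  revert z
  refine LinearMap.congr_fun (f := proj F G p q k h ∘ₗ ((tensorObj F G).d (k + 1) k).hom)
    (g := (F.d (p + 1) p).hom.rTensor (G.X q) ∘ₗ proj F G (p + 1) q (k + 1) (by omega) +
      (-1 : ℤˣ) ^ p • (G.d (q + 1) q).hom.lTensor (F.X p) ∘ₗ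
        proj F G p (q + 1) (k + 1) (by omega)) ?_
  refine linearMap_ext fun a b hab => LinearMap.ext fun t => ?_
  simp only [LinearMap.comp_apply, LinearMap.add_apply, LinearMap.smul_apply, d_incl, map_add]
  congr 1
  · rcases a with _ | a
    · rw [d₁_zero, proj_incl_of_ne _ _ _ _ (by omega)]
      simp
    · rw [d₁_succ _ _ _ _ _ (by omega)]
      by_cases hpa : p = a
      · subst hpa
        obtain rfl : b = q := by omega
        rw [proj_incl_self, proj_incl_self]
      · rw [proj_incl_of_ne _ _ _ _ (Ne.symm hpa), proj_incl_of_ne _ _ _ _ (by omega), map_zero]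
  · rcases b with _ | b
    · rw [d₂_zero, proj_incl_of_ne _ _ _ _ (by omega)]
      simp
    · rw [d₂_succ _ _ _ _ _ (by omega), LinearMap.map_smul_of_tower]
      by_cases hpa : p = a
      · subst hpa
        obtain rfl : b = q := by omega
        rw [proj_incl_self, proj_incl_self]
      · rw [proj_incl_of_ne _ _ _ _ (Ne.symm hpa), proj_incl_of_ne _ _ _ _ (Ne.symm hpa), map_zero,
          smul_zero, smul_zero]

end TensorTerm

/-! ### Monomial ideals -/

/-- The ideal generated by the monomials with exponents in `s`. -/
noncomputable def monomialIdeal (K : Type*) [Field K] {σ : Type*} (s : Set (σ →₀ ℕ)) :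
    Ideal (MvPolynomial σ K) :=
  Ideal.span ((fun e => MvPolynomial.monomial e (1 : K)) '' s)

namespace monomialIdeal

open MvPolynomial

variable {K : Type*} [Field K] {σ : Type*}

lemma mem_iff {s : Set (σ →₀ ℕ)} {p : MvPolynomial σ K} :
    p ∈ monomialIdeal K s ↔ ∀ e ∈ p.support, ∃ a ∈ s, a ≤ e :=
  mem_ideal_span_monomial_image

lemma monomial_mem_iff {s : Set (σ →₀ ℕ)} {e : σ →₀ ℕ} :
    monomial e (1 : K) ∈ monomialIdeal K s ↔ ∃ a ∈ s, a ≤ e := by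
  classical
  rw [mem_iff, support_monomial, if_neg one_ne_zero]
  simp

lemma sup_eq (s t : Set (σ →₀ ℕ)) :
    monomialIdeal K s ⊔ monomialIdeal K t = monomialIdeal K (s ∪ t) := by
  rw [monomialIdeal, monomialIdeal, monomialIdeal, Set.image_union, Ideal.span_union]

lemma insert_eq (m : σ →₀ ℕ) (s : Set (σ →₀ ℕ)) :
    monomialIdeal K (insert m s) = Ideal.span {monomial m 1} ⊔ monomialIdeal K s := by
  rw [monomialIdeal, Set.image_insert_eq, Ideal.span_insert, monomialIdeal]

lemma mul_eq (s t : Set (σ →₀ ℕ)) :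
    monomialIdeal K s * monomialIdeal K t = monomialIdeal K (Set.image2 (· + ·) s t) := by
  rw [monomialIdeal, monomialIdeal, Ideal.span_mul_span', monomialIdeal]
  congr 1
  rw [← Set.image2_mul, Set.image2_image_left, Set.image2_image_right, Set.image_image2]
  simp [monomial_mul]

/-- The exponents `a - m` with `a ∈ s` generate the colon ideal of `monomialIdeal K s` by the
monomial with exponent `m`. -/
lemma monomial_mul_mem_iff {s : Set (σ →₀ ℕ)} {m : σ →₀ ℕ} {p : MvPolynomial σ K} :
    monomial m 1 * p ∈ monomialIdeal K s ↔ p ∈ monomialIdeal K ((fun a => a - m) '' s) := by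
  classical
  simp only [mem_iff, Set.exists_mem_image, mem_support_iff, coeff_monomial_mul', one_mul]
  constructor
  · intro h e he
    obtain ⟨a, ha, hae⟩ := h (e + m) (by simpa using he)
    exact ⟨a, ha, tsub_le_iff_right.2 hae⟩
  · intro h e he
    split_ifs at he with hm
    · obtain ⟨a, ha, hae⟩ := h _ he
      refine ⟨a, ha, ?_⟩
      rw [tsub_le_iff_right, tsub_add_cancel_of_le hm] at hae
      exact hae
    · exact absurd rfl he

/-- If the monomial `m` shares no variable with the generators of `I`, then
`(I + J) : m = I + (J : m)` for monomial ideals `I` and `J`; this is the nontrivial inclusion. -/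
lemma mem_sup_of_monomial_mul_mem {s t : Set (σ →₀ ℕ)} {m : σ →₀ ℕ}
    (hm : ∀ a ∈ s, ∀ i, a i = 0 ∨ m i = 0) {p : MvPolynomial σ K}
    (hp : monomial m 1 * p ∈ monomialIdeal K s ⊔ monomialIdeal K t) :
    p ∈ monomialIdeal K s ⊔ monomialIdeal K ((fun a => a - m) '' t) := by
  rw [sup_eq, monomial_mul_mem_iff, Set.image_union] at hp
  rw [sup_eq]
  convert hp using 3
  symm
  refine (Set.image_congr fun a ha => ?_).trans (Set.image_id' s)
  ext i
  rcases hm a ha i with h | h <;> simp [h]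

end monomialIdeal

/-- The exponents of the minimal monomial generators of `I`. -/
def minimalExponents {K : Type*} [Field K] {σ : Type*} (I : Ideal (MvPolynomial σ K)) :
    Set (σ →₀ ℕ) :=
  {e | Minimal (fun e => MvPolynomial.monomial e (1 : K) ∈ I) e}

lemma exists_minimalExponents_le {K : Type*} [Field K] {n : ℕ}
    {I : Ideal (MvPolynomial (Fin n) K)} {e : Fin n →₀ ℕ}
    (he : MvPolynomial.monomial e (1 : K) ∈ I) : ∃ a ∈ minimalExponents I, a ≤ e := by
  obtain ⟨a, hae, ha⟩ := exists_minimal_le_of_wellFoundedLT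
    (fun e => MvPolynomial.monomial e (1 : K) ∈ I) e he
  exact ⟨a, ha, hae⟩

lemma IsMonomialIdeal.eq_minimalExponents {K : Type*} [Field K] {n : ℕ}
    {I : Ideal (MvPolynomial (Fin n) K)} (hI : IsMonomialIdeal I) :
    I = monomialIdeal K (minimalExponents I) := by
  apply le_antisymm
  · obtain ⟨S, hS⟩ := hI
    conv_lhs => rw [hS]
    refine Ideal.span_le.2 ?_
    rintro _ ⟨e, he, rfl⟩
    have : MvPolynomial.monomial e (1 : K) ∈ I := by
      rw [hS]
      exact Ideal.subset_span ⟨e, he, rfl⟩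
    exact monomialIdeal.monomial_mem_iff.2 (exists_minimalExponents_le this)
  · refine Ideal.span_le.2 ?_
    rintro _ ⟨e, he, rfl⟩
    exact he.1

/-- If `I * J = I ⊓ J` for monomial ideals, then no variable divides both a minimal monomial
generator of `I` and one of `J`. The proof considers a pair of generators with a common variable
and the smallest least common multiple. -/
lemma minimalExponents_disjoint {K : Type*} [Field K] {n : ℕ}
    {I J : Ideal (MvPolynomial (Fin n) K)} (hI : IsMonomialIdeal I) (hJ : IsMonomialIdeal J)
    (hIJ : I * J = I ⊓ J) {a b : Fin n →₀ ℕ} (ha : a ∈ minimalExponents I)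
    (hb : b ∈ minimalExponents J) : ∀ i, a i = 0 ∨ b i = 0 := by
  have key : ∀ e : Fin n →₀ ℕ, ∀ a ∈ minimalExponents I, ∀ b ∈ minimalExponents J, a ⊔ b = e →
      ∀ i, a i = 0 ∨ b i = 0 := by
    intro e
    induction e using WellFoundedLT.induction with
    | ind e ih =>
    intro a ha b hb hab
    by_contra hcon
    have hsmall : ∀ a' ∈ minimalExponents I, ∀ b' ∈ minimalExponents J, a' ⊔ b' ≤ e →
        a' ⊔ b' ≠ e → ∀ i, a' i = 0 ∨ b' i = 0 := fun a' ha' b' hb' hle hne =>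
      ih _ (lt_of_le_of_ne hle hne) a' ha' b' hb' rfl
    have hmem : MvPolynomial.monomial e (1 : K) ∈ I * J := by
      rw [hIJ, hI.eq_minimalExponents, hJ.eq_minimalExponents]
      exact ⟨monomialIdeal.monomial_mem_iff.2 ⟨a, ha, hab ▸ le_sup_left⟩,
        monomialIdeal.monomial_mem_iff.2 ⟨b, hb, hab ▸ le_sup_right⟩⟩
    rw [hI.eq_minimalExponents, hJ.eq_minimalExponents, monomialIdeal.mul_eq,
      monomialIdeal.monomial_mem_iff] at hmem
    obtain ⟨_, ⟨a', ha', b', hb', rfl⟩, hle⟩ := hmem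
    have hle' : ∀ i, a' i + b' i ≤ max (a i) (b i) := fun i => by
      have := hle i
      rw [← hab] at this
      simpa using this
    -- `a' ⊔ b' = e` would force `a' + b' = a' ⊔ b'`
    have hdisj : ∀ i, a' i = 0 ∨ b' i = 0 := by
      by_cases h : a' ⊔ b' = e
      · intro i
        have h1 := hle i
        rw [← h] at h1
        simp only [Finsupp.add_apply, Finsupp.sup_apply] at h1
        omega
      · refine hsmall a' ha' b' hb' (le_trans ?_ hle) h
        exact sup_le le_self_add le_add_self
    have hab' : ¬ ∀ i, a' i = 0 ∨ b i = 0 := by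
      intro h
      have hle2 : a' ≤ a := fun i => by
        have := hle' i
        rcases h i with h | h <;> omega
      obtain rfl := le_antisymm hle2 (ha.2 ha'.1 hle2)
      exact hcon h
    have hsup : a' ⊔ b = e := by
      by_contra hne
      refine hab' (hsmall a' ha' b hb ?_ hne)
      rw [← hab]
      refine sup_le (fun i => ?_) le_sup_right
      have := hle' i
      simp only [Finsupp.sup_apply]
      omega
    have hle3 : b' ≤ b := fun i => by
      have h1 := hle i
      rw [← hsup] at h1
      simp only [Finsupp.add_apply, Finsupp.sup_apply] at h1
      rcases hdisj i with h | h <;> omega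
    obtain rfl := le_antisymm hle3 (hb.2 hb'.1 hle3)
    exact hab' hdisj
  exact key _ a ha b hb rfl

lemma IsMonomialIdeal.exists_finset {K : Type*} [Field K] {n : ℕ}
    {I : Ideal (MvPolynomial (Fin n) K)} (hI : IsMonomialIdeal I) :
    ∃ s : Finset (Fin n →₀ ℕ), (s : Set (Fin n →₀ ℕ)) ⊆ minimalExponents I ∧
      I = monomialIdeal K (s : Set (Fin n →₀ ℕ)) := by
  classical
  have hfg : (monomialIdeal K (minimalExponents I)).FG := IsNoetherian.noetherian _
  obtain ⟨t, ht, hspan⟩ := (Submodule.fg_span_iff_fg_span_finset_subset _).1 hfg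
  obtain ⟨s, hs, rfl⟩ := Finset.subset_set_image_iff.1 ht
  refine ⟨s, hs, hI.eq_minimalExponents.trans ?_⟩
  rw [Finset.coe_image] at hspan
  exact hspan

/-! ### Exactness modulo a monomial ideal -/

lemma Module.Basis.mem_ideal_smul_top_iff {R M ι : Type*} [CommRing R] [AddCommGroup M]
    [Module R M] [Finite ι] (b : Module.Basis ι R M) {I : Ideal R} {x : M} :
    x ∈ I • (⊤ : Submodule R M) ↔ ∀ j, b.repr x j ∈ I := by
  cases nonempty_fintype ι
  constructor
  · intro hx j
    refine Submodule.smul_induction_on hx (fun r hr y _ => ?_) fun y z hy hz => ?_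
    · simpa using I.mul_mem_right _ hr
    · simpa using I.add_mem hy hz
  · intro h
    rw [← b.sum_repr x]
    exact Submodule.sum_mem _ fun j _ => Submodule.smul_mem_smul (h j) trivial

lemma LinearMap.map_mem_ideal_smul_top {R M N : Type*} [CommRing R] [AddCommGroup M]
    [Module R M] [AddCommGroup N] [Module R N] (f : M →ₗ[R] N) {I : Ideal R} {x : M}
    (hx : x ∈ I • (⊤ : Submodule R M)) : f x ∈ I • (⊤ : Submodule R N) :=
  Submodule.smul_top_le_comap_smul_top I f hx

lemma Submodule.exists_sub_smul_mem_of_mem_span_singleton_sup_smul_top {R M : Type*} [CommRing R]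
    [AddCommGroup M] [Module R M] {m : R} {I : Ideal R} {x : M}
    (hx : x ∈ (Ideal.span {m} ⊔ I) • (⊤ : Submodule R M)) :
    ∃ y, x - m • y ∈ I • (⊤ : Submodule R M) := by
  rw [Submodule.sup_smul] at hx
  obtain ⟨y, hy, z, hz, rfl⟩ := Submodule.mem_sup.1 hx
  rw [Submodule.ideal_span_singleton_smul] at hy
  obtain ⟨y, -, rfl⟩ := (Submodule.mem_smul_pointwise_iff_exists _ _ _).1 hy
  exact ⟨y, by simpa using hz⟩

open MvPolynomial in
/-- The complex `F ⊗ R ⧸ J` is exact in positive degrees if `F` is a free resolution of `R ⧸ I`,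
where `I` and `J` are generated by monomials in disjoint sets of variables; exactness is expressed
without the quotients `F_i ⧸ J F_i`. The number of generators of `J` is reduced by means of the
exact sequence `0 → R ⧸ (J' : m) → R ⧸ J' → R ⧸ (J' + (m)) → 0`. -/
theorem mem_range_sup_of_d_mem_monomialIdeal_smul_top {K : Type u} [Field K] {n : ℕ}
    (F : ChainComplex (ModuleCat.{u} (MvPolynomial (Fin n) K)) ℕ) {ι : ℕ → Type*}
    [∀ i, Finite (ι i)] (basis : ∀ i, Module.Basis (ι i) (MvPolynomial (Fin n) K) (F.X i))
    {s : Set (Fin n →₀ ℕ)}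
    (aug : F.X 0 →ₗ[MvPolynomial (Fin n) K] MvPolynomial (Fin n) K ⧸ monomialIdeal K s)
    (aug_surjective : Function.Surjective aug) (exact_zero : Function.Exact (F.d 1 0).hom aug)
    (exact_succ : ∀ i : ℕ, Function.Exact (F.d (i + 2) (i + 1)).hom (F.d (i + 1) i).hom)
    (t : Finset (Fin n →₀ ℕ)) (hst : ∀ a ∈ s, ∀ b ∈ t, ∀ i, a i = 0 ∨ b i = 0) (i : ℕ)
    (x : F.X (i + 1))
    (hx : (F.d (i + 1) i).hom x ∈ monomialIdeal K (t : Set (Fin n →₀ ℕ)) •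
      (⊤ : Submodule (MvPolynomial (Fin n) K) (F.X i))) :
    x ∈ LinearMap.range (F.d (i + 2) (i + 1)).hom ⊔ monomialIdeal K (t : Set (Fin n →₀ ℕ)) •
      (⊤ : Submodule (MvPolynomial (Fin n) K) (F.X (i + 1))) := by
  classical
  obtain ⟨N, hN⟩ : ∃ N, t.card ≤ N := ⟨_, le_rfl⟩
  induction N generalizing t i with
  | zero =>
    obtain rfl : t = ∅ := Finset.card_eq_zero.1 (Nat.le_zero.1 hN)
    have h0 : monomialIdeal K ((∅ : Finset (Fin n →₀ ℕ)) : Set (Fin n →₀ ℕ)) = ⊥ := by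
      simp [monomialIdeal]
    rw [h0, Submodule.bot_smul, Submodule.mem_bot] at hx
    exact Submodule.mem_sup_left ((exact_succ i x).1 hx)
  | succ N ih =>
    obtain rfl | ⟨m, hm⟩ := t.eq_empty_or_nonempty
    · exact ih ∅ (by simp) i x hx (by simp)
    obtain ⟨t, hmt, rfl⟩ : ∃ t', m ∉ t' ∧ insert m t' = t :=
      ⟨t.erase m, Finset.notMem_erase _ _, Finset.insert_erase hm⟩
    rw [Finset.card_insert_of_notMem hmt, add_le_add_iff_right] at hN
    have ht : ∀ a ∈ s, ∀ b ∈ t, ∀ i, a i = 0 ∨ b i = 0 := fun a ha b hb =>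
      hst a ha b (Finset.mem_insert_of_mem hb)
    have hm : ∀ a ∈ s, ∀ i, a i = 0 ∨ m i = 0 := fun a ha =>
      hst a ha m (Finset.mem_insert_self _ _)
    -- `t'` generates the colon ideal of `t` by the monomial `m`
    set t' : Finset (Fin n →₀ ℕ) := t.image (fun a => a - m) with ht'_def
    have ht'_coe : (t' : Set (Fin n →₀ ℕ)) = (fun a => a - m) '' (t : Set _) := by
      simp [ht'_def]
    have ht' : ∀ a ∈ s, ∀ b ∈ t', ∀ i, a i = 0 ∨ b i = 0 := by
      intro a ha b hb i
      obtain ⟨c, hc, rfl⟩ := Finset.mem_image.1 hb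
      rcases ht a ha c hc i with h | h <;> simp [h]
    have hcolon : ∀ (j : ℕ) (y : F.X j),
        (monomial m (1 : K)) • y ∈ monomialIdeal K (t : Set (Fin n →₀ ℕ)) •
          (⊤ : Submodule (MvPolynomial (Fin n) K) (F.X j)) ↔
        y ∈ monomialIdeal K (t' : Set (Fin n →₀ ℕ)) •
          (⊤ : Submodule (MvPolynomial (Fin n) K) (F.X j)) := by
      intro j y
      rw [(basis j).mem_ideal_smul_top_iff, (basis j).mem_ideal_smul_top_iff]
      simp [ht'_coe, monomialIdeal.monomial_mul_mem_iff]
    rw [Finset.coe_insert, monomialIdeal.insert_eq] at hx ⊢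
    obtain ⟨y, hy⟩ := Submodule.exists_sub_smul_mem_of_mem_span_singleton_sup_smul_top hx
    -- `x` maps to `m y` modulo `t`; modulo the boundaries, `y` lies in the colon ideal times `F_i`
    obtain ⟨c, hc⟩ : ∃ c, y - (F.d (i + 1) i).hom c ∈ monomialIdeal K (t' : Set (Fin n →₀ ℕ)) •
        (⊤ : Submodule (MvPolynomial (Fin n) K) (F.X i)) := by
      rcases i with _ | i
      -- in degree `0` the augmentation takes the place of the differential
      · obtain ⟨e, he⟩ := aug_surjective 1
        obtain ⟨r, hr⟩ := Ideal.Quotient.mk_surjective (aug y)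
        have h1 : monomial m 1 * r ∈ monomialIdeal K s ⊔
            monomialIdeal K (t : Set (Fin n →₀ ℕ)) := by
          have h2 := aug.map_mem_ideal_smul_top hy
          rw [map_sub, exact_zero.apply_apply_eq_zero, zero_sub, map_smul, ← hr,
            Submodule.neg_mem_iff] at h2
          have h3 : (Ideal.Quotient.mk (monomialIdeal K s)) (monomial m 1 * r) ∈
              (monomialIdeal K (t : Set (Fin n →₀ ℕ))).map
                (Ideal.Quotient.mk (monomialIdeal K s)) := by
            rw [Ideal.smul_top_eq_map] at h2
            exact h2
          rw [sup_comm, ← Ideal.mem_quotient_iff_mem_sup]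
          exact h3
        have h4 := monomialIdeal.mem_sup_of_monomial_mul_mem hm h1
        rw [← ht'_coe] at h4
        obtain ⟨p, hp, q, hq, hpq⟩ := Submodule.mem_sup.1 h4
        have h5 : aug (y - q • e) = 0 := by
          rw [map_sub, map_smul, he, ← hr, ← hpq, map_add, Ideal.Quotient.eq_zero_iff_mem.2 hp,
            zero_add, sub_eq_zero]
          exact congrArg _ (mul_one q).symm
        obtain ⟨c, hc⟩ := (exact_zero _).1 h5
        refine ⟨c, ?_⟩
        rw [hc, sub_sub_cancel]
        exact Submodule.smul_mem_smul hq trivial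
      · have h1 : (F.d (i + 1) i).hom y ∈ monomialIdeal K (t' : Set (Fin n →₀ ℕ)) •
            (⊤ : Submodule (MvPolynomial (Fin n) K) (F.X i)) := by
          have h2 := (F.d (i + 1) i).hom.map_mem_ideal_smul_top hy
          rw [map_sub, (exact_succ i).apply_apply_eq_zero, zero_sub, map_smul,
            Submodule.neg_mem_iff] at h2
          exact (hcolon i _).1 h2
        have h3 := ih t' ht' i y h1 (Finset.card_image_le.trans hN)
        obtain ⟨_, ⟨c, rfl⟩, l, hl, rfl⟩ := Submodule.mem_sup.1 h3
        exact ⟨c, by simpa using hl⟩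
    have h1 : (F.d (i + 1) i).hom (x - (monomial m (1 : K)) • c) ∈
        monomialIdeal K (t : Set (Fin n →₀ ℕ)) •
          (⊤ : Submodule (MvPolynomial (Fin n) K) (F.X i)) := by
      have h2 := Submodule.add_mem _ hy ((hcolon i _).2 hc)
      convert h2 using 1
      rw [map_sub, map_smul, smul_sub]
      abel
    have h2 := ih t ht i _ h1 hN
    rw [← sub_add_cancel x ((monomial m (1 : K)) • c), Submodule.sup_smul]
    refine Submodule.add_mem _ ?_ ?_
    · exact SetLike.le_def.1 (sup_le_sup_left le_sup_right _) h2
    · exact Submodule.mem_sup_right (Submodule.mem_sup_left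
        (Submodule.smul_mem_smul (Ideal.mem_span_singleton_self _) trivial))

/-! ### Exactness and minimality of tensor product complexes -/

namespace TensorProduct

variable {R : Type*} [CommRing R] {M M' N N' : Type*} [AddCommGroup M] [Module R M]
  [AddCommGroup M'] [Module R M'] [AddCommGroup N] [Module R N] [AddCommGroup N'] [Module R N']

/-- The map `M ⊗ N → M ⧸ J M` induced by a linear map `N → R ⧸ J`. -/
noncomputable def toQuotSMulTop (M : Type*) [AddCommGroup M] [Module R M] {J : Ideal R}
    (g : N →ₗ[R] R ⧸ J) : M ⊗[R] N →ₗ[R] M ⧸ (J • (⊤ : Submodule R M)) :=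
  (tensorQuotEquivQuotSMul M J).toLinearMap ∘ₗ g.lTensor M

variable {J : Ideal R} {g : N →ₗ[R] R ⧸ J}

lemma toQuotSMulTop_surjective (hg : Function.Surjective g) :
    Function.Surjective (toQuotSMulTop M g) :=
  (tensorQuotEquivQuotSMul M J).surjective.comp (LinearMap.lTensor_surjective M hg)

lemma toQuotSMulTop_exact {f : N' →ₗ[R] N} (hfg : Function.Exact f g)
    (hg : Function.Surjective g) : Function.Exact (f.lTensor M) (toQuotSMulTop M g) := by
  intro z
  rw [← lTensor_exact M hfg hg z]
  exact (tensorQuotEquivQuotSMul M J).map_eq_zero_iff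

lemma toQuotSMulTop_rTensor (f : M →ₗ[R] M') (z : M ⊗[R] N) :
    toQuotSMulTop M' g (f.rTensor N z) =
      Submodule.mapQ _ _ f (Submodule.smul_top_le_comap_smul_top J f) (toQuotSMulTop M g z) := by
  induction z with
  | zero => simp
  | add x y hx hy => simp only [map_add, hx, hy]
  | tmul x y =>
    obtain ⟨r, hr⟩ := Ideal.Quotient.mk_surjective (g y)
    simp only [toQuotSMulTop, LinearMap.comp_apply, LinearMap.rTensor_tmul, LinearMap.lTensor_tmul,
      LinearEquiv.coe_coe, ← hr, tensorQuotEquivQuotSMul_tmul_mk]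
    rw [← map_smul]
    rfl

/-- Lifting of the exactness of `F ⊗ R ⧸ J` at one spot to `F ⊗ G₀`, modulo the image of
`F ⊗ G₁`, where `G₁ → G₀ → R ⧸ J → 0` is exact. -/
lemma exists_eq_rTensor_add_lTensor {M'' : Type*} [AddCommGroup M''] [Module R M'']
    {d : M →ₗ[R] M'} {d' : M' →ₗ[R] M''} {f : N' →ₗ[R] N} (hfg : Function.Exact f g)
    (hg : Function.Surjective g)
    (H : ∀ x : M', d' x ∈ J • (⊤ : Submodule R M'') →
      x ∈ LinearMap.range d ⊔ J • (⊤ : Submodule R M'))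
    {z : M' ⊗[R] N} (hz : d'.rTensor N z ∈ LinearMap.range (f.lTensor M'')) :
    ∃ y w, z = d.rTensor N y + f.lTensor M' w := by
  obtain ⟨x, hx⟩ := Submodule.mkQ_surjective _ (toQuotSMulTop M' g z)
  have h1 : toQuotSMulTop M'' g (d'.rTensor N z) = 0 := (toQuotSMulTop_exact hfg hg _).2 hz
  rw [toQuotSMulTop_rTensor, ← hx, Submodule.mkQ_apply, Submodule.mapQ_apply,
    Submodule.Quotient.mk_eq_zero] at h1
  obtain ⟨_, ⟨c, rfl⟩, l, hl, rfl⟩ := Submodule.mem_sup.1 (H x h1)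
  obtain ⟨y, hy⟩ := toQuotSMulTop_surjective (M := M) hg (Submodule.Quotient.mk c)
  have h2 : toQuotSMulTop M' g (z - d.rTensor N y) = 0 := by
    rw [map_sub, toQuotSMulTop_rTensor, hy, ← hx, Submodule.mapQ_apply, Submodule.mkQ_apply,
      ← Submodule.Quotient.mk_sub, Submodule.Quotient.mk_eq_zero, add_sub_cancel_left]
    exact hl
  obtain ⟨w, hw⟩ := (toQuotSMulTop_exact hfg hg _).1 h2
  exact ⟨y, w, by rw [hw]; abel⟩

/-- The multiplication map `R ⧸ I ⊗ R ⧸ J → R ⧸ (I + J)`. -/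
noncomputable def quotMul (I J : Ideal R) : (R ⧸ I) ⊗[R] (R ⧸ J) →ₗ[R] R ⧸ (I + J) :=
  TensorProduct.lift ((LinearMap.mul R (R ⧸ (I + J))).compl₁₂
    (Ideal.Quotient.factorₐ R (le_sup_left : I ≤ I + J)).toLinearMap
    (Ideal.Quotient.factorₐ R (le_sup_right : J ≤ I + J)).toLinearMap)

lemma quotMul_mk_tmul_mk (I J : Ideal R) (a b : R) :
    quotMul I J (Ideal.Quotient.mk I a ⊗ₜ Ideal.Quotient.mk J b) =
      Ideal.Quotient.mk (I + J) (a * b) := by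
  simp [quotMul]

lemma quotMul_surjective (I J : Ideal R) : Function.Surjective (quotMul I J) := fun x => by
  obtain ⟨r, rfl⟩ := Ideal.Quotient.mk_surjective x
  exact ⟨Ideal.Quotient.mk I r ⊗ₜ Ideal.Quotient.mk J 1, by rw [quotMul_mk_tmul_mk, mul_one]⟩

/-- Every element of `R ⧸ I ⊗ R ⧸ J` is a pure tensor `r ⊗ 1`, and `r ⊗ 1` vanishes for `r` in `I`
and for `r` in `J`. -/
lemma quotMul_injective (I J : Ideal R) : Function.Injective (quotMul I J) := by
  have hrep : ∀ t : (R ⧸ I) ⊗[R] (R ⧸ J), ∃ r : R,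
      t = Ideal.Quotient.mk I r ⊗ₜ Ideal.Quotient.mk J 1 := by
    intro t
    induction t with
    | zero => exact ⟨0, by simp⟩
    | add x y hx hy =>
      obtain ⟨r, rfl⟩ := hx
      obtain ⟨s, rfl⟩ := hy
      exact ⟨r + s, by rw [map_add, add_tmul]⟩
    | tmul x y =>
      obtain ⟨a, rfl⟩ := Ideal.Quotient.mk_surjective x
      obtain ⟨b, rfl⟩ := Ideal.Quotient.mk_surjective y
      refine ⟨b * a, ?_⟩
      have h1 : Ideal.Quotient.mk J b = b • Ideal.Quotient.mk J 1 :=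
        (congrArg (Ideal.Quotient.mk J) (mul_one b)).symm
      rw [h1, ← smul_tmul]
      rfl
  rw [injective_iff_map_eq_zero]
  intro t ht
  obtain ⟨r, rfl⟩ := hrep t
  rw [quotMul_mk_tmul_mk, mul_one, Ideal.Quotient.eq_zero_iff_mem] at ht
  obtain ⟨i, hi, j, hj, rfl⟩ := Submodule.mem_sup.1 ht
  have h1 : (Ideal.Quotient.mk I j : R ⧸ I) = j • Ideal.Quotient.mk I 1 :=
    (congrArg (Ideal.Quotient.mk I) (mul_one j)).symm
  have h2 : j • (Ideal.Quotient.mk J 1 : R ⧸ J) = Ideal.Quotient.mk J j :=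
    congrArg (Ideal.Quotient.mk J) (mul_one j)
  rw [map_add, Ideal.Quotient.eq_zero_iff_mem.2 hi, zero_add, h1, smul_tmul, h2,
    Ideal.Quotient.eq_zero_iff_mem.2 hj, tmul_zero]

end TensorProduct

namespace TensorTerm

open HomologicalComplex TensorProduct

variable {R : Type u} [CommRing R] (F G : ChainComplex (ModuleCat.{u} R) ℕ)

lemma neg_one_pow_smul_smul {M : Type*} [AddCommGroup M] (p : ℕ) (x : M) :
    (-1 : ℤˣ) ^ p • (-1 : ℤˣ) ^ p • x = x := by
  rw [smul_smul, ← mul_pow]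
  simp

/-- If the `F_p ⊗ G` are exact in positive degrees and `F ⊗ (G₀ ⧸ d G₁)` is exact in positive
degrees, then so is `F ⊗ G`: a cycle is modified by boundaries until its components in
`F_p ⊗ G_q` vanish, for increasing `q`. -/
theorem exact_succ
    (hrow : ∀ p q, Function.Exact ((G.d (q + 2) (q + 1)).hom.lTensor (F.X p))
      ((G.d (q + 1) q).hom.lTensor (F.X p)))
    (hcol : ∀ (p : ℕ) (z : F.X (p + 1) ⊗[R] G.X 0),
      (F.d (p + 1) p).hom.rTensor (G.X 0) z ∈
        LinearMap.range ((G.d 1 0).hom.lTensor (F.X p)) →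
      ∃ y w, z = (F.d (p + 2) (p + 1)).hom.rTensor (G.X 0) y +
        (G.d 1 0).hom.lTensor (F.X (p + 1)) w)
    (k : ℕ) : Function.Exact ((tensorObj F G).d (k + 2) (k + 1)).hom
      ((tensorObj F G).d (k + 1) k).hom := by
  have hdd : ∀ y,
      ((tensorObj F G).d (k + 1) k).hom (((tensorObj F G).d (k + 2) (k + 1)).hom y) = 0 :=
    fun y => LinearMap.congr_fun (congrArg ModuleCat.Hom.hom
      ((tensorObj F G).d_comp_d (k + 2) (k + 1) k)) y
  suffices h : ∀ m, ∀ z, ((tensorObj F G).d (k + 1) k).hom z = 0 →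
      (∀ p q (h : p + q = k + 1), q + m < k + 2 → proj F G p q (k + 1) h z = 0) →
      ∃ y, ((tensorObj F G).d (k + 2) (k + 1)).hom y = z by
    intro z
    refine ⟨fun hz => h (k + 2) z hz fun p q _ hq => absurd hq (by omega), ?_⟩
    rintro ⟨y, rfl⟩
    exact hdd y
  intro m
  induction m with
  | zero =>
    intro z _ hz
    refine ⟨0, ?_⟩
    rw [map_zero]
    exact ext_proj F G fun p q h => by rw [map_zero, hz p q h (by omega)]
  | succ m ih =>
    intro z hdz hz
    by_cases hm : k + 2 ≤ m
    · exact ih z hdz fun p q h hq => absurd hq (by omega)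
    -- it suffices to find `y` such that `d y` and `z` agree in the relevant components
    suffices h : ∃ y, ∀ p q (h : p + q = k + 1), q + m < k + 2 →
        proj F G p q (k + 1) h (((tensorObj F G).d (k + 2) (k + 1)).hom y) =
          proj F G p q (k + 1) h z by
      obtain ⟨y, hy⟩ := h
      obtain ⟨y', hy'⟩ := ih (z - ((tensorObj F G).d (k + 2) (k + 1)).hom y)
        (by rw [map_sub, hdz, hdd, sub_zero])
        (fun p q h hq => by rw [map_sub, hy p q h hq, sub_self])
      exact ⟨y' + y, by rw [map_add, hy', sub_add_cancel]⟩
    by_cases hmk : m = k + 1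
    -- here only the component of `z` in `F_{k+1} ⊗ G₀` remains to be matched
    · subst hmk
      have h1 := proj_d F G k 0 k rfl z
      rw [hdz, map_zero] at h1
      obtain ⟨y, w, hyw⟩ := hcol k (proj F G (k + 1) 0 (k + 1) rfl z) (by
        rw [eq_neg_of_add_eq_zero_left h1.symm, Units.smul_def]
        exact Submodule.neg_mem _ (zsmul_mem (LinearMap.mem_range_self _ _) _))
      refine ⟨incl F G (k + 2) 0 (k + 2) rfl y +
        (-1 : ℤˣ) ^ (k + 1) • incl F G (k + 1) 1 (k + 2) rfl w, fun p q h hq => ?_⟩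
      obtain rfl : q = 0 := by omega
      obtain rfl : p = k + 1 := by omega
      rw [proj_d, hyw]
      simp only [map_add, LinearMap.map_smul_of_tower, proj_incl_self]
      rw [proj_incl_of_ne _ _ _ _ (by omega), proj_incl_of_ne _ _ _ _ (by omega)]
      simp only [map_zero, smul_zero, add_zero, zero_add, neg_one_pow_smul_smul]
    -- here the components of `z` before the one in `F_m ⊗ G_{q+1}` vanish
    · obtain ⟨q, hq⟩ : ∃ q, m + q = k := ⟨k - m, by omega⟩
      have h1 := proj_d F G m q k hq z
      rw [hdz, map_zero, hz (m + 1) q (by omega) (by omega), map_zero, zero_add] at h1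
      have h2 : (G.d (q + 1) q).hom.lTensor (F.X m)
          (proj F G m (q + 1) (k + 1) (by omega) z) = 0 := by
        rw [← neg_one_pow_smul_smul m ((G.d (q + 1) q).hom.lTensor (F.X m) _), ← h1, smul_zero]
      obtain ⟨w, hw⟩ := (hrow m q _).1 h2
      refine ⟨(-1 : ℤˣ) ^ m • incl F G m (q + 2) (k + 2) (by omega) w, fun p q' h hq' => ?_⟩
      rw [proj_d]
      simp only [LinearMap.map_smul_of_tower]
      rw [proj_incl_of_ne _ _ _ _ (by omega), map_zero, smul_zero, zero_add]
      by_cases hp : m = p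
      · subst hp
        obtain rfl : q' = q + 1 := by omega
        rw [proj_incl_self, hw, neg_one_pow_smul_smul]
      · rw [proj_incl_of_ne _ _ _ _ hp, map_zero, smul_zero, smul_zero, hz p q' h (by omega)]

variable {F G} {I J : Ideal R}

/-- The augmentation `F₀ ⊗ G₀ → R ⧸ (I + J)` of the tensor product complex. -/
noncomputable def aug (f : F.X 0 →ₗ[R] R ⧸ I) (g : G.X 0 →ₗ[R] R ⧸ J) :
    (tensorObj F G).X 0 →ₗ[R] R ⧸ (I + J) :=
  quotMul I J ∘ₗ TensorProduct.map f g ∘ₗ proj F G 0 0 0 rfl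

lemma aug_surjective {f : F.X 0 →ₗ[R] R ⧸ I} {g : G.X 0 →ₗ[R] R ⧸ J}
    (hf : Function.Surjective f) (hg : Function.Surjective g) :
    Function.Surjective (aug f g) := by
  refine (quotMul_surjective I J).comp ((TensorProduct.map_surjective hf hg).comp fun t => ?_)
  exact ⟨incl F G 0 0 0 rfl t, proj_incl_self _ _ _ _ _ _ _⟩

lemma exact_zero {f : F.X 0 →ₗ[R] R ⧸ I} {g : G.X 0 →ₗ[R] R ⧸ J}
    (hf : Function.Surjective f) (hg : Function.Surjective g)
    (hdf : Function.Exact (F.d 1 0).hom f) (hdg : Function.Exact (G.d 1 0).hom g) :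
    Function.Exact ((tensorObj F G).d 1 0).hom (aug f g) := by
  intro z
  have h1 : aug f g z = 0 ↔ proj F G 0 0 0 rfl z ∈
      LinearMap.range ((G.d 1 0).hom.lTensor (F.X 0)) ⊔
        LinearMap.range ((F.d 1 0).hom.rTensor (G.X 0)) := by
    rw [← TensorProduct.map_ker hdf hf hdg hg, LinearMap.mem_ker]
    exact map_eq_zero_iff _ (quotMul_injective I J)
  rw [h1]
  constructor
  · intro h
    obtain ⟨_, ⟨w, rfl⟩, _, ⟨y, rfl⟩, hyw⟩ := Submodule.mem_sup.1 h
    refine ⟨incl F G 1 0 1 rfl y + incl F G 0 1 1 rfl w, ext_proj F G fun p q h => ?_⟩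
    obtain rfl : p = 0 := by omega
    obtain rfl : q = 0 := by omega
    rw [proj_d, ← hyw]
    simp only [map_add, proj_incl_self]
    rw [proj_incl_of_ne _ _ _ _ (by omega), proj_incl_of_ne _ _ _ _ (by omega)]
    simp [add_comm]
  · rintro ⟨y, rfl⟩
    rw [proj_d, pow_zero, one_smul, add_comm]
    exact Submodule.add_mem_sup (LinearMap.mem_range_self _ _) (LinearMap.mem_range_self _ _)

/-- Minimality passes to tensor products of complexes. -/
lemma range_d_le {𝔪 : Ideal R}
    (hF : ∀ i, LinearMap.range (F.d (i + 1) i).hom ≤ 𝔪 • (⊤ : Submodule R (F.X i)))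
    (hG : ∀ i, LinearMap.range (G.d (i + 1) i).hom ≤ 𝔪 • (⊤ : Submodule R (G.X i))) (k : ℕ) :
    LinearMap.range ((tensorObj F G).d (k + 1) k).hom ≤
      𝔪 • (⊤ : Submodule R ((tensorObj F G).X k)) := by
  rintro _ ⟨z, rfl⟩
  rw [← sum_incl_proj F G (((tensorObj F G).d (k + 1) k).hom z)]
  refine Submodule.sum_mem _ fun x _ => LinearMap.map_mem_ideal_smul_top _ ?_
  rw [proj_d, Units.smul_def]
  refine Submodule.add_mem _ ?_ (zsmul_mem ?_ _)
  · generalize proj F G _ _ _ _ z = t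
    induction t with
    | zero => simp
    | add a b ha hb => rw [map_add]; exact Submodule.add_mem _ ha hb
    | tmul a b =>
      exact LinearMap.map_mem_ideal_smul_top ((TensorProduct.mk R _ _).flip b)
        (hF _ (LinearMap.mem_range_self _ a))
  · generalize proj F G _ _ _ _ z = t
    induction t with
    | zero => simp
    | add a b ha hb => rw [map_add]; exact Submodule.add_mem _ ha hb
    | tmul a b =>
      exact LinearMap.map_mem_ideal_smul_top (TensorProduct.mk R _ _ a)
        (hG _ (LinearMap.mem_range_self _ b))

section Basis

variable {ι κ : ℕ → Type*} (b : ∀ i, Module.Basis (ι i) R (F.X i))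
  (c : ∀ i, Module.Basis (κ i) R (G.X i))

/-- The basis of the tensor product complex in degree `k` that consists of the tensor products of
basis elements of `F_p` and `G_q` for `p + q = k`. -/
noncomputable def basis (k : ℕ) :
    Module.Basis (Σ x : BidegreesOfTotal k, ι x.1.1 × κ x.1.2) R ((tensorObj F G).X k) :=
  (Pi.basis fun x : BidegreesOfTotal k => (b x.1.1).tensorProduct (c x.1.2)).map
    (equiv F G k).symm

lemma basis_repr (k : ℕ) (z : (tensorObj F G).X k) (x : BidegreesOfTotal k)
    (j : ι x.1.1 × κ x.1.2) : (basis b c k).repr z ⟨x, j⟩ =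
      ((b x.1.1).tensorProduct (c x.1.2)).repr (proj F G x.1.1 x.1.2 k x.2 z) j := rfl

lemma basis_apply (k : ℕ) (x : BidegreesOfTotal k) (j : ι x.1.1 × κ x.1.2) :
    basis b c k ⟨x, j⟩ = incl F G x.1.1 x.1.2 k x.2 (b x.1.1 j.1 ⊗ₜ c x.1.2 j.2) := by
  classical
  rw [basis, Module.Basis.map_apply, Pi.basis_apply, equiv_symm_single,
    Module.Basis.tensorProduct_apply']

end Basis

end TensorTerm

/-! ### Tensor products of graded free resolutions -/

namespace TensorTerm

open HomologicalComplex TensorProduct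

lemma isWeightedHomogeneous_basis_repr_d {K : Type u} [Field K] {n : ℕ} {A : Type v}
    [AddCommGroup A] {w : Fin n → A} {F G : ChainComplex (ModuleCat.{u} (MvPolynomial (Fin n) K)) ℕ}
    {ι κ : ℕ → Type*} (b : ∀ i, Module.Basis (ι i) (MvPolynomial (Fin n) K) (F.X i))
    (c : ∀ i, Module.Basis (κ i) (MvPolynomial (Fin n) K) (G.X i))
    {degF : ∀ i, ι i → A} {degG : ∀ i, κ i → A}
    (hF : ∀ i j k, MvPolynomial.IsWeightedHomogeneous w
      ((b i).repr ((F.d (i + 1) i).hom (b (i + 1) j)) k) (degF (i + 1) j - degF i k))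
    (hG : ∀ i j k, MvPolynomial.IsWeightedHomogeneous w
      ((c i).repr ((G.d (i + 1) i).hom (c (i + 1) j)) k) (degG (i + 1) j - degG i k))
    (k : ℕ) (y : Σ x : BidegreesOfTotal (k + 1), ι x.1.1 × κ x.1.2)
    (x : Σ x : BidegreesOfTotal k, ι x.1.1 × κ x.1.2) :
    MvPolynomial.IsWeightedHomogeneous w
      ((basis b c k).repr (((tensorObj F G).d (k + 1) k).hom (basis b c (k + 1) y)) x)
      ((degF _ y.2.1 + degG _ y.2.2) - (degF _ x.2.1 + degG _ x.2.2)) := by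
  classical
  obtain ⟨⟨⟨p', q'⟩, h'⟩, j', l'⟩ := y
  obtain ⟨⟨⟨p, q⟩, h⟩, j, l⟩ := x
  dsimp only at h h' j l j' l' ⊢
  rw [basis_repr, basis_apply, proj_d, map_add, Finsupp.add_apply]
  refine MvPolynomial.IsWeightedHomogeneous.add ?_ ?_
  · by_cases hp : p' = p + 1
    · subst hp
      obtain rfl : q' = q := by omega
      rw [proj_incl_self, LinearMap.rTensor_tmul, Module.Basis.tensorProduct_repr_tmul_apply,
        Module.Basis.repr_self]
      by_cases hl : l' = l
      · subst hl
        rw [Finsupp.single_eq_same, one_smul, add_sub_add_right_eq_sub]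
        exact hF _ _ _
      · rw [Finsupp.single_eq_of_ne' hl, zero_smul]
        exact MvPolynomial.isWeightedHomogeneous_zero _ _ _
    · rw [proj_incl_of_ne _ _ _ _ hp, map_zero, map_zero]
      exact MvPolynomial.isWeightedHomogeneous_zero _ _ _
  · by_cases hp : p' = p
    · subst hp
      obtain rfl : q' = q + 1 := by omega
      rw [proj_incl_self, LinearMap.lTensor_tmul]
      have h1 : MvPolynomial.IsWeightedHomogeneous w
          (((b p').tensorProduct (c q)).repr (b p' j' ⊗ₜ (G.d (q + 1) q).hom (c (q + 1) l')) (j, l))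
          ((degF _ j' + degG _ l') - (degF _ j + degG _ l)) := by
        rw [Module.Basis.tensorProduct_repr_tmul_apply, Module.Basis.repr_self]
        by_cases hj : j' = j
        · subst hj
          rw [Finsupp.single_eq_same, smul_eq_mul, mul_one, add_sub_add_left_eq_sub]
          exact hG _ _ _
        · rw [Finsupp.single_eq_of_ne' hj, smul_zero]
          exact MvPolynomial.isWeightedHomogeneous_zero _ _ _
      rcases neg_one_pow_eq_or ℤˣ p' with h2 | h2
      · rw [h2, one_smul]
        exact h1
      · rw [h2, Units.neg_smul, one_smul, map_neg, Finsupp.neg_apply]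
        exact (MvPolynomial.weightedHomogeneousSubmodule K w _).neg_mem h1
    · rw [proj_incl_of_ne _ _ _ _ hp, map_zero, smul_zero, map_zero]
      exact MvPolynomial.isWeightedHomogeneous_zero _ _ _

end TensorTerm

/-- Tensoring with the free modules `F_p` preserves the exactness of `G`, and by the vanishing of
the homology of `F ⊗ R ⧸ J` the hypotheses of `TensorTerm.exact_succ` hold. -/
theorem GradedFreeResolution.tensorObj_exact_succ {K : Type u} [Field K] {n : ℕ} {A : Type v}
    [AddCommGroup A] {w : Fin n → A} {I J : Ideal (MvPolynomial (Fin n) K)}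
    (hI : IsMonomialIdeal I) (hJ : IsMonomialIdeal J) (hIJ : I * J = I ⊓ J)
    {F G : ChainComplex (ModuleCat.{u} (MvPolynomial (Fin n) K)) ℕ}
    (f : GradedFreeResolution w I F) (g : GradedFreeResolution w J G) (k : ℕ) :
    Function.Exact ((HomologicalComplex.tensorObj F G).d (k + 2) (k + 1)).hom
      ((HomologicalComplex.tensorObj F G).d (k + 1) k).hom := by
  have hfree : ∀ p, Module.Free (MvPolynomial (Fin n) K) (F.X p) := fun p =>
    Module.Free.of_basis (f.basis p)
  refine TensorTerm.exact_succ F G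
    (fun p q => Module.Flat.lTensor_exact _ (g.exact_succ q)) (fun p z hz => ?_) k
  refine TensorProduct.exists_eq_rTensor_add_lTensor g.exact_zero g.aug_surjective
    (fun x hx => ?_) hz
  obtain ⟨s, hs, hIs⟩ := hI.exists_finset
  obtain ⟨t, ht, hJt⟩ := hJ.exists_finset
  have hst : ∀ a ∈ (s : Set (Fin n →₀ ℕ)), ∀ b ∈ t, ∀ i, a i = 0 ∨ b i = 0 := fun a ha b hb =>
    minimalExponents_disjoint hI hJ hIJ (hs ha) (ht hb)
  clear hs
  subst hIs
  rw [hJt] at hx ⊢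
  exact mem_range_sup_of_d_mem_monomialIdeal_smul_top F f.basis f.aug f.aug_surjective
    f.exact_zero f.exact_succ t hst p x hx

/-- The graded free resolution structure on the tensor product: a basis element `x ⊗ y` has
degree `deg x + deg y`. -/
noncomputable def GradedFreeResolution.tensorObj {K : Type u} [Field K] {n : ℕ} {A : Type v}
    [AddCommGroup A] {w : Fin n → A} {I J : Ideal (MvPolynomial (Fin n) K)}
    (hI : IsMonomialIdeal I) (hJ : IsMonomialIdeal J) (hIJ : I * J = I ⊓ J)
    {F G : ChainComplex (ModuleCat.{u} (MvPolynomial (Fin n) K)) ℕ}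
    (f : GradedFreeResolution w I F) (g : GradedFreeResolution w J G) :
    GradedFreeResolution w (I + J) (HomologicalComplex.tensorObj F G) where
  rank k := Fintype.card (Σ x : BidegreesOfTotal k, Fin (f.rank x.1.1) × Fin (g.rank x.1.2))
  basis k := (TensorTerm.basis f.basis g.basis k).reindex (Fintype.equivFin _)
  deg k j := f.deg _ ((Fintype.equivFin _).symm j).2.1 + g.deg _ ((Fintype.equivFin _).symm j).2.2
  aug := TensorTerm.aug f.aug g.aug
  d_homogeneous i j k := by
    rw [Module.Basis.repr_reindex_apply, Module.Basis.reindex_apply]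
    exact TensorTerm.isWeightedHomogeneous_basis_repr_d f.basis g.basis f.d_homogeneous
      g.d_homogeneous i _ _
  aug_homogeneous j := by
    rw [Module.Basis.reindex_apply]
    generalize (Fintype.equivFin _).symm j = y
    obtain ⟨⟨⟨p, q⟩, h⟩, j, l⟩ := y
    obtain ⟨rfl, rfl⟩ : p = 0 ∧ q = 0 := by dsimp only at h; omega
    obtain ⟨a, ha, ha'⟩ := f.aug_homogeneous j
    obtain ⟨b, hb, hb'⟩ := g.aug_homogeneous l
    refine ⟨a * b, ha.mul hb, ?_⟩
    rw [TensorTerm.basis_apply, ← TensorProduct.quotMul_mk_tmul_mk, ← ha', ← hb', TensorTerm.aug,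
      LinearMap.comp_apply, LinearMap.comp_apply, TensorTerm.proj_incl_self,
      TensorProduct.map_tmul]
  aug_surjective := TensorTerm.aug_surjective f.aug_surjective g.aug_surjective
  exact_zero := TensorTerm.exact_zero f.aug_surjective g.aug_surjective f.exact_zero g.exact_zero
  exact_succ := f.tensorObj_exact_succ hI hJ hIJ g

theorem mainTheorem4 {K : Type u} [Field K] {n : ℕ} {A : Type v} [AddCommGroup A]
    (w : Fin n → A) (I J : Ideal (MvPolynomial (Fin n) K))
    (hI : IsMonomialIdeal I) (hJ : IsMonomialIdeal J) (hIJ : I * J = I ⊓ J)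
    (F G : ChainComplex (ModuleCat.{u} (MvPolynomial (Fin n) K)) ℕ)
    (hF : IsMinimalFreeResolution w I F) (hG : IsMinimalFreeResolution w J G) :
    IsMinimalFreeResolution w (I + J) (HomologicalComplex.tensorObj F G) := by
  obtain ⟨⟨f⟩, hFm⟩ := hF
  obtain ⟨⟨g⟩, hGm⟩ := hG
  exact ⟨⟨f.tensorObj hI hJ hIJ g⟩, TensorTerm.range_d_le hFm hGm⟩
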